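/- Let $k$ be a non-negative integer. Let $\mathcal{SY}_k$ be the directed graph of strict partitions with at most $k$ parts: its vertices are the vectors $(c_1,\dots,c_k)$ of non-negative integers with $c_1\ge c_2\ge\dots\ge c_k$ such that $c_i=c_j$ with $i\ne j$ implies $c_i=0$, and there is an edge from $c$ to $c'$ exactly when $c'$ is obtained from $c$ by increasing one coordinate by $1$. Let $u=(m_1,\dots,m_k)$ (written as the monomial $\prod_i x_i^{m_i}$) be a vertex of $\mathcal{SY}_k$ and put $n=\sum_i m_i$. Then the number of directed paths in $\mathcal{SY}_k$ from the origin $(0,\dots,0)$ to $u$ equals $$\prod_{1\le i<j\le k}\frac{m_i-m_j}{m_i+m_j}\cdot\frac{n!}{\prod_{i=1}^k m_i!},$$ where the factor $\frac{m_i-m_j}{m_i+m_j}$ is understood to be $1$ when $m_i=m_j=0$. Moreover, this number equals the number of standard shifted tableaux of shape $u$, that is, of bijective fillings by $1,\dots,n$ of the shifted diagram $\{(i,j): 1\le i\le k,\ i\le j\le i+m_i-1\}$ (row $i$, column $j$) which increase along each row and down each column. -/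

import Mathlib

/-- The vertices of the graph of strict partitions with at most `k` non-zero parts: vectors
`(c₁, …, c_k)` of non-negative integers, `c₁ ≥ c₂ ≥ ⋯ ≥ c_k`, in which two coordinates with
distinct indices are equal only if they vanish. -/
def StrictYoung (k : ℕ) : Type :=
  {c : Fin k → ℕ // Antitone c ∧ ∀ i j : Fin k, i ≠ j → c i = c j → c i = 0}

/-- The directed graph structure: an edge `u ⟶ v` is an index `i` such that `v` is obtained from
`u` by increasing the `i`-th coordinate by `1` (there is at most one such index). -/
instance StrictYoung.instQuiver (k : ℕ) : Quiver (StrictYoung k) where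
  Hom u v := {i : Fin k // v.1 = u.1 + Pi.single i 1}

/-- The origin `(0, …, 0)`, that is, the monomial `1`. -/
def StrictYoung.origin (k : ℕ) : StrictYoung k :=
  ⟨fun _ => 0, fun _ _ _ => le_rfl, fun _ _ _ _ => rfl⟩

/-- The number of directed paths from `v` to `u` in the graph of strict partitions. -/
noncomputable def StrictYoung.pathCount {k : ℕ} (v u : StrictYoung k) : ℕ :=
  Nat.card (Quiver.Path v u)

/-- The cells of the shifted diagram of `u`: the `i`-th row (counted from `0`) has `u i` cells and
is moved `i` columns to the right. A cell is a pair (row, column). -/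
def StrictYoung.ShiftedCell {k : ℕ} (u : StrictYoung k) : Type :=
  {p : Fin k × ℕ // (p.1 : ℕ) ≤ p.2 ∧ p.2 < (p.1 : ℕ) + u.1 p.1}

/-- The standard shifted tableaux of shape `u`: bijective fillings of the cells of the shifted
diagram by an `n`-element chain, `n = ∑ i, u i`, increasing along each row and down each column. -/
def StrictYoung.ShiftedTableau {k : ℕ} (u : StrictYoung k) : Type :=
  {T : u.ShiftedCell ≃ Fin (∑ i, u.1 i) //
    (∀ a b : u.ShiftedCell, a.1.1 = b.1.1 → a.1.2 < b.1.2 → T a < T b) ∧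
    (∀ a b : u.ShiftedCell, a.1.2 = b.1.2 → a.1.1 < b.1.1 → T a < T b)}

/-- The quotient `(a - b) / (a + b)`, with the convention that it is `1` for `a = b = 0`. -/
def strictFactor (a b : ℕ) : ℚ :=
  if a = 0 ∧ b = 0 then 1 else ((a : ℚ) - (b : ℚ)) / ((a : ℚ) + (b : ℚ))

/-! Path counts are determined by their value 1 at the origin and the recursion over the last edge,
so it suffices that the product formula obeys that recursion (`sum_inEdge_strictPathFormula`).
Lowering a positive coordinate that breaks strictness makes the formula vanish, so the sum may run
over all positive coordinates. After division by the formula at `u`, the recursion becomes the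
rational identity `sum_mul_prod_decRatio`, an instance of Lagrange interpolation. For tableaux, the
largest entry occupies a removable corner, and deleting it undoes the last edge of a path
(`standardEnumEquiv`). -/

/-! ### Interpolation and the rational identity. -/

/-- Both sides are the coefficient of degree `s.card - 1` of `∏ (X - z j) - ∏ (X - y j)`: the
leading terms cancel, so the difference is interpolated by its values at the nodes `y i`, where the
second product vanishes. -/
theorem sum_prod_sub_div_prod_sub {ι F : Type*} [DecidableEq ι] [Field F] (s : Finset ι)
    (y z : ι → F) (hy : Set.InjOn y s) :
    ∑ i ∈ s, (∏ j ∈ s, (y i - z j)) / ∏ j ∈ s.erase i, (y i - y j) = ∑ i ∈ s, (y i - z i) := by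
  rcases s.eq_empty_or_nonempty with rfl | hs
  · simp
  have hd : (Lagrange.nodal s z - Lagrange.nodal s y).degree < s.card := by
    rw [← Lagrange.degree_nodal (s := s) (v := z)]
    apply Polynomial.degree_sub_lt_left
    · rw [Lagrange.degree_nodal, Lagrange.degree_nodal]
    · exact Lagrange.nodal_ne_zero
    · rw [Lagrange.nodal_monic.leadingCoeff, Lagrange.nodal_monic.leadingCoeff]
  have h := Lagrange.coeff_eq_sum hy hd
  rw [Polynomial.coeff_sub, Lagrange.nodal_eq, Lagrange.nodal_eq,
    Polynomial.prod_X_sub_C_coeff_card_pred _ _ hs.card_pos,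
    Polynomial.prod_X_sub_C_coeff_card_pred _ _ hs.card_pos] at h
  rw [Finset.sum_sub_distrib, ← neg_sub_neg, h]
  refine Finset.sum_congr rfl fun i hi => ?_
  rw [← Lagrange.nodal_eq, ← Lagrange.nodal_eq, Polynomial.eval_sub,
    Lagrange.eval_nodal_at_node hi, sub_zero, Lagrange.eval_nodal]

/-- The ratio `strictFactor (a - 1) b / strictFactor a b`. -/
def decRatio (a b : ℕ) : ℚ :=
  if b = 0 then 1 else ((a : ℚ) - 1 - b) * (a + b) / ((a - 1 + b) * (a - b))

theorem strictFactor_sub_one_left {a b : ℕ} (ha : 0 < a) (hab : a ≠ b) :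
    strictFactor (a - 1) b = strictFactor a b * decRatio a b := by
  obtain ⟨a, rfl⟩ := Nat.exists_eq_add_of_lt ha
  rcases Nat.eq_zero_or_pos b with rfl | hb
  · rcases Nat.eq_zero_or_pos a with rfl | ha'
    -- Here the entries are 1 and 0; the conventions for `strictFactor 0 0` and `decRatio 1 0`
    -- replace quotients `0 / 0`.
    · simp [strictFactor, decRatio]
    · have h1 : (a : ℚ) ≠ 0 := by positivity
      have h2 : (a : ℚ) + 1 ≠ 0 := by positivity
      simp [strictFactor, decRatio, ha'.ne', h1, h2]
  · have h1 : (a : ℚ) + b ≠ 0 := by positivity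
    have h2 : (a : ℚ) + 1 + b ≠ 0 := by positivity
    have h3 : (a : ℚ) + 1 - b ≠ 0 := by
      rw [sub_ne_zero]; exact_mod_cast (by omega : a + 1 ≠ b)
    simp only [strictFactor, decRatio, hb.ne', zero_add, Nat.add_sub_cancel, and_false, if_false]
    push_cast
    rw [add_sub_cancel_right]
    field_simp

theorem strictFactor_swap {a b : ℕ} (hab : a ≠ 0 ∨ b ≠ 0) :
    strictFactor a b = -strictFactor b a := by
  rw [strictFactor, strictFactor, if_neg (by tauto), if_neg (by tauto), ← neg_div, neg_sub,
    add_comm (a : ℚ)]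

theorem strictFactor_sub_one_right {a b : ℕ} (ha : 0 < a) (hb : a < b) :
    strictFactor b (a - 1) = strictFactor b a * decRatio a b := by
  rw [strictFactor_swap (Or.inl (by omega)), strictFactor_sub_one_left ha hb.ne,
    strictFactor_swap (a := b) (Or.inl (by omega)), neg_mul]

theorem sum_mul_prod_decRatio {ι : Type*} [DecidableEq ι] (s : Finset ι) (m : ι → ℕ)
    (hm : ∀ i ∈ s, 0 < m i) (hinj : Set.InjOn m s) :
    ∑ i ∈ s, (m i : ℚ) * ∏ j ∈ s.erase i, decRatio (m i) (m j) = ∑ i ∈ s, (m i : ℚ) := by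
  -- Chosen because `(a-1-b)(a+b) = a(a-1) - b(b+1)` and `(a-1+b)(a-b) = a(a-1) - b(b-1)`. The
  -- factor `j = i` of the numerator is `-2 * m i`.
  have key := sum_prod_sub_div_prod_sub s (fun i => (m i : ℚ) * (m i - 1))
    (fun i => (m i : ℚ) * (m i + 1)) ?_
  · have h : ∀ i ∈ s, (∏ j ∈ s, ((m i : ℚ) * (m i - 1) - m j * (m j + 1))) /
        ∏ j ∈ s.erase i, ((m i : ℚ) * (m i - 1) - m j * (m j - 1)) =
        -2 * (m i * ∏ j ∈ s.erase i, decRatio (m i) (m j)) := by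
      intro i hi
      rw [← Finset.mul_prod_erase s _ hi, mul_div_assoc, ← Finset.prod_div_distrib, ← mul_assoc]
      congr 1
      · ring
      · refine Finset.prod_congr rfl fun j hj => ?_
        rw [decRatio, if_neg (hm j (Finset.mem_of_mem_erase hj)).ne']
        congr 1 <;> ring
    rw [Finset.sum_congr rfl h, ← Finset.mul_sum] at key
    have h2 : ∑ i ∈ s, ((m i : ℚ) * (m i - 1) - m i * (m i + 1)) = -2 * ∑ i ∈ s, (m i : ℚ) := by
      rw [Finset.mul_sum]
      exact Finset.sum_congr rfl fun i _ => by ring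
    rw [h2] at key
    linarith
  · intro i hi j hj hij
    have h1 : (1 : ℚ) ≤ m i := by exact_mod_cast hm i hi
    have h2 : (1 : ℚ) ≤ m j := by exact_mod_cast hm j hj
    have h3 : ((m i : ℚ) - m j) * (m i + m j - 1) = 0 := by
      simp only at hij
      linear_combination hij
    rcases mul_eq_zero.1 h3 with h | h
    · exact hinj hi hj (by exact_mod_cast sub_eq_zero.1 h)
    · linarith

/-! ### The recursion for the product formula. -/

/-- The product formula for the number of paths from the origin to `c`. -/
noncomputable def strictPathFormula {k : ℕ} (c : Fin k → ℕ) : ℚ :=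
  (∏ i : Fin k, ∏ j ∈ Finset.Ioi i, strictFactor (c i) (c j)) *
    ((Nat.factorial (∑ i, c i) : ℚ) / ∏ i, (Nat.factorial (c i) : ℚ))

theorem strictPathFormula_eq_zero {k : ℕ} {c : Fin k → ℕ} {i j : Fin k} (hij : i < j)
    (h : c i = c j) (h0 : c i ≠ 0) : strictPathFormula c = 0 := by
  rw [strictPathFormula, Finset.prod_eq_zero (Finset.mem_univ i), zero_mul]
  apply Finset.prod_eq_zero (Finset.mem_Ioi.2 hij)
  simp [strictFactor, ← h, h0]

namespace StrictYoung

theorem lt_of_lt {k : ℕ} (u : StrictYoung k) {i j : Fin k} (hij : i < j) (hi : 0 < u.1 i) :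
    u.1 j < u.1 i :=
  lt_of_le_of_ne (u.2.1 hij.le) fun h => hi.ne' (u.2.2 i j hij.ne h.symm)

theorem ne_of_ne {k : ℕ} (u : StrictYoung k) {i j : Fin k} (hij : i ≠ j) (hi : 0 < u.1 i) :
    u.1 i ≠ u.1 j :=
  fun h => hi.ne' (u.2.2 i j hij h)

theorem strictPathFormula_update {k : ℕ} (u : StrictYoung k) {i : Fin k} (hi : 0 < u.1 i) :
    (∑ j, u.1 j : ℕ) * strictPathFormula (Function.update u.1 i (u.1 i - 1)) =
      strictPathFormula u.1 *
        (u.1 i * ∏ j ∈ Finset.univ.erase i, decRatio (u.1 i) (u.1 j)) := by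
  set c := Function.update u.1 i (u.1 i - 1) with hc
  have hfac : ∏ j, (Nat.factorial (u.1 j) : ℚ) = u.1 i * ∏ j, (Nat.factorial (c j) : ℚ) := by
    rw [← Finset.mul_prod_erase _ _ (Finset.mem_univ i),
      ← Finset.mul_prod_erase Finset.univ (fun j => (Nat.factorial (c j) : ℚ))
        (Finset.mem_univ i), ← mul_assoc]
    congr 1
    · rw [hc, Function.update_self]
      exact_mod_cast (Nat.mul_factorial_pred hi.ne').symm
    · refine Finset.prod_congr rfl fun j hj => ?_
      rw [hc, Function.update_of_ne (Finset.ne_of_mem_erase hj)]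
  have hsum : ∑ j, u.1 j = ∑ j, c j + 1 := by
    rw [← Finset.add_sum_erase _ _ (Finset.mem_univ i),
      ← Finset.add_sum_erase Finset.univ c (Finset.mem_univ i)]
    have : ∑ j ∈ Finset.univ.erase i, c j = ∑ j ∈ Finset.univ.erase i, u.1 j :=
      Finset.sum_congr rfl fun j hj => by
        rw [hc, Function.update_of_ne (Finset.ne_of_mem_erase hj)]
    rw [this, hc, Function.update_self]
    omega
  have hprod : ∏ a : Fin k, ∏ b ∈ Finset.Ioi a, strictFactor (c a) (c b) =
      (∏ a : Fin k, ∏ b ∈ Finset.Ioi a, strictFactor (u.1 a) (u.1 b)) *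
        ∏ j ∈ Finset.univ.erase i, decRatio (u.1 i) (u.1 j) := by
    have h : ∀ a : Fin k, ∀ b ∈ Finset.Ioi a, strictFactor (c a) (c b) =
        strictFactor (u.1 a) (u.1 b) * ((if a = i then decRatio (u.1 i) (u.1 b) else 1) *
          (if b = i then decRatio (u.1 i) (u.1 a) else 1)) := by
      intro a b hb
      rw [Finset.mem_Ioi] at hb
      by_cases ha : a = i
      · subst ha
        rw [if_pos rfl, if_neg hb.ne', mul_one, hc, Function.update_self,
          Function.update_of_ne hb.ne',
          strictFactor_sub_one_left hi (u.ne_of_ne hb.ne hi)]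
      · by_cases hb' : b = i
        · subst hb'
          rw [if_pos rfl, if_neg ha, one_mul, hc, Function.update_self,
            Function.update_of_ne ha, strictFactor_sub_one_right hi
              (u.lt_of_lt hb (hi.trans_le (u.2.1 hb.le)))]
        · rw [if_neg ha, if_neg hb', hc, Function.update_of_ne ha, Function.update_of_ne hb',
            mul_one, mul_one]
    rw [Finset.prod_congr rfl fun a _ => Finset.prod_congr rfl (h a)]
    simp only [Finset.prod_mul_distrib]
    congr 1
    have hl : ∏ a : Fin k, ∏ b ∈ Finset.Ioi a, (if a = i then decRatio (u.1 i) (u.1 b) else 1) =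
        ∏ b ∈ Finset.Ioi i, decRatio (u.1 i) (u.1 b) := by
      rw [Finset.prod_eq_single i]
      · simp
      · intro a _ ha
        simp [ha]
      · simp
    have hr : ∏ a : Fin k, ∏ b ∈ Finset.Ioi a, (if b = i then decRatio (u.1 i) (u.1 a) else 1) =
        ∏ a ∈ Finset.Iio i, decRatio (u.1 i) (u.1 a) := by
      simp only [Finset.prod_ite_eq', Finset.mem_Ioi]
      rw [← Finset.prod_filter]
      exact Finset.prod_congr (by ext; simp) fun _ _ => rfl
    rw [hl, hr, ← Finset.prod_union]
    · refine Finset.prod_congr ?_ fun _ _ => rfl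
      ext j
      simp only [Finset.mem_union, Finset.mem_Ioi, Finset.mem_Iio, Finset.mem_erase,
        Finset.mem_univ, and_true]
      exact (ne_comm.trans lt_or_lt_iff_ne.symm).symm
    · rw [Finset.disjoint_left]
      intro j h1 h2
      exact lt_asymm (Finset.mem_Ioi.1 h1) (Finset.mem_Iio.1 h2)
  have h1 : ∏ j, (Nat.factorial (c j) : ℚ) ≠ 0 :=
    Finset.prod_ne_zero_iff.2 fun j _ => by positivity
  have h2 : (u.1 i : ℚ) ≠ 0 := by positivity
  rw [strictPathFormula, strictPathFormula, hprod, hfac, hsum, Nat.factorial_succ]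
  push_cast
  field_simp

theorem strictPathFormula_eq_sum {k : ℕ} (u : StrictYoung k) (hu : ∑ i, u.1 i ≠ 0) :
    strictPathFormula u.1 = ∑ i with 0 < u.1 i,
      strictPathFormula (Function.update u.1 i (u.1 i - 1)) := by
  have h0 : ((∑ i, u.1 i : ℕ) : ℚ) ≠ 0 := by exact_mod_cast hu
  apply mul_left_cancel₀ h0
  rw [Finset.mul_sum, Finset.sum_congr rfl fun i hi =>
    u.strictPathFormula_update (Finset.mem_filter.1 hi).2, ← Finset.mul_sum, mul_comm]
  congr 1
  have hs : ((∑ i, u.1 i : ℕ) : ℚ) = ∑ i with 0 < u.1 i, (u.1 i : ℚ) := by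
    push_cast
    symm
    apply Finset.sum_filter_of_ne
    intro i _ h
    exact Nat.pos_of_ne_zero (by exact_mod_cast h)
  rw [hs, ← sum_mul_prod_decRatio]
  · refine Finset.sum_congr rfl fun i hi => ?_
    congr 1
    -- Vanishing coordinates contribute the factor 1.
    apply Finset.prod_subset
    · exact Finset.erase_subset_erase _ (Finset.filter_subset _ _)
    · intro j hj hj'
      have : u.1 j = 0 := by
        by_contra h
        exact hj' (by simp_all [Nat.pos_iff_ne_zero])
      simp [decRatio, this]
  · exact fun i hi => (Finset.mem_filter.1 hi).2
  · intro i hi j _ hij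
    by_contra h
    exact u.ne_of_ne h (Finset.mem_filter.1 hi).2 hij

end StrictYoung
-- Counting paths by their last edge.
namespace StrictYoung

variable {k : ℕ}

theorem sum_eq_of_hom {v u : StrictYoung k} (e : v ⟶ u) : ∑ i, u.1 i = ∑ i, v.1 i + 1 := by
  rw [e.2]
  simp [Finset.sum_add_distrib]

theorem eq_origin_of_sum_eq_zero {u : StrictYoung k} (hu : ∑ i, u.1 i = 0) : u = origin k := by
  apply Subtype.ext
  funext i
  exact Finset.sum_eq_zero_iff.1 hu i (Finset.mem_univ i)

theorem sum_origin : ∑ i, (origin k).1 i = 0 := by simp [origin]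

/-- The edges with target `u`. -/
abbrev InEdge (u : StrictYoung k) : Type := Σ v : StrictYoung k, (v ⟶ u)

theorem inEdge_index_injective (u : StrictYoung k) :
    Function.Injective fun e : u.InEdge => e.2.1 := by
  rintro ⟨v, i, hv⟩ ⟨w, j, hw⟩ h
  obtain rfl : i = j := h
  obtain rfl : v = w := Subtype.ext (add_right_cancel (hv.symm.trans hw))
  rfl

noncomputable instance (u : StrictYoung k) : Fintype u.InEdge :=
  have := Finite.of_injective _ u.inEdge_index_injective
  Fintype.ofFinite _

/-- A path ending at a vertex other than the origin is a path followed by an edge. -/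
noncomputable def pathEquiv (u : StrictYoung k) (hu : ∑ i, u.1 i ≠ 0) :
    (Σ e : u.InEdge, Quiver.Path (origin k) e.1) ≃ Quiver.Path (origin k) u :=
  Equiv.ofBijective (fun p => p.2.cons p.1.2) <| by
    constructor
    · rintro ⟨⟨v, e⟩, p⟩ ⟨⟨w, f⟩, q⟩ h
      cases h
      rfl
    · intro p
      cases p with
      | nil => exact absurd sum_origin hu
      | cons p e => exact ⟨⟨⟨_, e⟩, p⟩, rfl⟩

theorem path_origin_origin (p : Quiver.Path (origin k) (origin k)) : p = .nil := by
  cases p with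
  | nil => rfl
  | cons p e => exact absurd (sum_eq_of_hom e) (by rw [sum_origin]; omega)

theorem update_eq_of_hom {v u : StrictYoung k} (e : v ⟶ u) :
    Function.update u.1 e.1 (u.1 e.1 - 1) = v.1 := by
  funext j
  have h := congr_fun e.2 j
  by_cases hj : j = e.1
  · subst hj
    rw [Function.update_self, h]
    simp
  · rw [Function.update_of_ne hj, h]
    simp [hj]

theorem hom_pos {v u : StrictYoung k} (e : v ⟶ u) : 0 < u.1 e.1 := by
  rw [congr_fun e.2 e.1]
  simp

/-- A positive coordinate that can be decreased by `1` is the index of an edge ending in `u`. -/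
theorem exists_inEdge (u : StrictYoung k) {i : Fin k} (hi : 0 < u.1 i)
    (h : ∀ j, i < j → u.1 j = u.1 i - 1 → u.1 j = 0) : ∃ e : u.InEdge, e.2.1 = i := by
  refine ⟨⟨⟨Function.update u.1 i (u.1 i - 1), ?_, ?_⟩, i, ?_⟩, rfl⟩
  · intro a b hab
    rcases hab.eq_or_lt with rfl | hab
    · rfl
    by_cases ha : a = i
    · subst ha
      rw [Function.update_self, Function.update_of_ne hab.ne']
      exact Nat.le_sub_one_of_lt (u.lt_of_lt hab hi)
    · rw [Function.update_of_ne ha]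
      by_cases hb : b = i
      · subst hb
        rw [Function.update_self]
        exact (Nat.sub_le _ _).trans (u.2.1 hab.le)
      · rw [Function.update_of_ne hb]
        exact u.2.1 hab.le
  · have key : ∀ b, b ≠ i → u.1 b = u.1 i - 1 → u.1 b = 0 := by
      intro b hb hbi
      rcases lt_or_gt_of_ne hb with hlt | hgt
      · have := u.2.1 hlt.le
        omega
      · exact h b hgt hbi
    intro a b hab hE
    by_cases ha : a = i
    · subst ha
      rw [Function.update_self, Function.update_of_ne hab.symm] at hE
      rw [Function.update_self, hE, key b hab.symm hE.symm]
    · by_cases hb : b = i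
      · subst hb
        rw [Function.update_self, Function.update_of_ne ha] at hE
        rw [Function.update_of_ne ha, key a ha hE]
      · rw [Function.update_of_ne ha, Function.update_of_ne hb] at hE
        rw [Function.update_of_ne ha]
        exact u.2.2 a b hab hE
  · funext j
    by_cases hj : j = i
    · subst hj
      simp only [Pi.add_apply, Function.update_self, Pi.single_eq_same]
      omega
    · simp [hj]

theorem sum_inEdge_strictPathFormula (u : StrictYoung k) (hu : ∑ i, u.1 i ≠ 0) :
    ∑ e : u.InEdge, strictPathFormula e.1.1 = strictPathFormula u.1 := by
  rw [u.strictPathFormula_eq_sum hu]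
  refine Finset.sum_of_injOn (fun e => e.2.1) u.inEdge_index_injective.injOn ?_ ?_ ?_
  · intro e _
    simpa using hom_pos e.2
  · intro i hi hne
    have hi := (Finset.mem_filter.1 hi).2
    -- If `i` indexes no edge, lowering it produces two equal non-zero coordinates.
    have : ¬ ∀ j, i < j → u.1 j = u.1 i - 1 → u.1 j = 0 := by
      intro h
      obtain ⟨e, rfl⟩ := u.exists_inEdge hi h
      exact hne ⟨e, by simp, rfl⟩
    push Not at this
    obtain ⟨j, hij, hj, h0⟩ := this
    apply strictPathFormula_eq_zero hij
    · rw [Function.update_self, Function.update_of_ne hij.ne', hj]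
    · rw [Function.update_self, ← hj]
      exact h0
  · intro e _
    rw [update_eq_of_hom]

/-- Finiteness is part of the induction because `Nat.card` is additive over the last edge only for
finite fibres. -/
theorem finite_path_and_pathCount_eq (n : ℕ) (u : StrictYoung k) (hu : ∑ i, u.1 i = n) :
    Finite (Quiver.Path (origin k) u) ∧ ((origin k).pathCount u : ℚ) = strictPathFormula u.1 := by
  induction n generalizing u with
  | zero =>
    obtain rfl := eq_origin_of_sum_eq_zero hu
    have : Unique (Quiver.Path (origin k) (origin k)) := ⟨⟨.nil⟩, path_origin_origin⟩
    refine ⟨inferInstance, ?_⟩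
    rw [pathCount, Nat.card_unique]
    simp [strictPathFormula, origin, strictFactor]
  | succ n ih =>
    have hu0 : ∑ i, u.1 i ≠ 0 := by omega
    have ih' (e : u.InEdge) := ih e.1 (by have := sum_eq_of_hom e.2; omega)
    have hfin (e : u.InEdge) : Finite (Quiver.Path (origin k) e.1) := (ih' e).1
    refine ⟨Finite.of_equiv _ (u.pathEquiv hu0), ?_⟩
    rw [pathCount, ← Nat.card_congr (u.pathEquiv hu0), Nat.card_sigma, Nat.cast_sum,
      ← u.sum_inEdge_strictPathFormula hu0]
    exact Finset.sum_congr rfl fun e _ => (ih' e).2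

end StrictYoung
-- Shifted tableaux and removal of the largest entry.
namespace StrictYoung

variable {k : ℕ}

/-- Each row starts one column further right but is shorter by at least one, so right ends of
non-empty rows never move right going down. -/
theorem add_le_add_of_le (u : StrictYoung k) {i j : Fin k} (hij : i ≤ j) (hj : 0 < u.1 j) :
    (j : ℕ) + u.1 j ≤ (i : ℕ) + u.1 i := by
  obtain ⟨d, hd⟩ := Nat.exists_eq_add_of_le (Fin.le_def.1 hij)
  induction d generalizing j with
  | zero =>
    obtain rfl : j = i := Fin.ext hd
    exact le_rfl
  | succ d ih =>
    have hlt := j.2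
    let j' : Fin k := ⟨i + d, by omega⟩
    have hj' : j' < j := Fin.lt_def.2 (by simp only [j']; omega)
    have h1 := u.lt_of_lt hj' (hj.trans_le (u.2.1 hj'.le))
    have h2 := ih (j := j') (Fin.le_def.2 (by simp [j'])) (hj.trans h1) rfl
    simp only [j'] at h1 h2
    omega

/-- The cells of the shifted diagram of `u`, as a set. -/
def shiftedDiagram (u : StrictYoung k) : Set (Fin k × ℕ) :=
  {p | (p.1 : ℕ) ≤ p.2 ∧ p.2 < (p.1 : ℕ) + u.1 p.1}

/-- An enumeration `g` of the shifted diagram of `u` is standard if it is the inverse of a standard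
shifted tableau. -/
structure IsStandardEnum (u : StrictYoung k) {n : ℕ} (g : Fin n → Fin k × ℕ) : Prop where
  injective : Function.Injective g
  range_eq : Set.range g = u.shiftedDiagram
  row : ∀ s t, (g s).1 = (g t).1 → (g s).2 < (g t).2 → s < t
  col : ∀ s t, (g s).2 = (g t).2 → (g s).1 < (g t).1 → s < t

/-- Standard shifted tableaux correspond to standard enumerations of the cells. -/
noncomputable def shiftedTableauEquiv (u : StrictYoung k) :
    u.ShiftedTableau ≃ {g : Fin (∑ i, u.1 i) → Fin k × ℕ // u.IsStandardEnum g} :=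
  Equiv.ofBijective
    (fun T => ⟨fun s => (T.1.symm s).1, {
      injective := Subtype.val_injective.comp T.1.symm.injective
      range_eq := by
        exact (T.1.symm.surjective.range_comp Subtype.val).trans Subtype.range_coe
      row := fun s t h1 h2 => by simpa using T.2.1 _ _ h1 h2
      col := fun s t h1 h2 => by simpa using T.2.2 _ _ h1 h2 }⟩) <| by
    constructor
    · intro T T' h
      apply Subtype.ext
      apply Equiv.symm_bijective.injective
      ext1 s
      exact Subtype.ext (congr_fun (congr_arg Subtype.val h) s)
    · rintro ⟨g, hg⟩
      have hmem (s) : g s ∈ u.shiftedDiagram := hg.range_eq ▸ Set.mem_range_self s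
      let E : Fin (∑ i, u.1 i) ≃ u.ShiftedCell :=
        Equiv.ofBijective (fun s => ⟨g s, hmem s⟩)
          ⟨fun s t h => hg.injective (congr_arg Subtype.val h), fun p => by
            obtain ⟨s, hs⟩ : p.1 ∈ Set.range g := hg.range_eq ▸ p.2
            exact ⟨s, Subtype.ext hs⟩⟩
      have hE (a : u.ShiftedCell) : g (E.symm a) = a.1 :=
        congr_arg Subtype.val (E.apply_symm_apply a)
      refine ⟨⟨E.symm, fun a b h1 h2 => ?_, fun a b h1 h2 => ?_⟩, rfl⟩
      · exact hg.row _ _ (by rwa [hE, hE]) (by rwa [hE, hE])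
      · exact hg.col _ _ (by rwa [hE, hE]) (by rwa [hE, hE])

/-- The cell that is added along an edge. -/
def newCell {v u : StrictYoung k} (e : v ⟶ u) : Fin k × ℕ := (e.1, (e.1 : ℕ) + v.1 e.1)

theorem newCell_notMem {v u : StrictYoung k} (e : v ⟶ u) : newCell e ∉ v.shiftedDiagram :=
  fun h => lt_irrefl _ h.2

theorem apply_index_of_hom {v u : StrictYoung k} (e : v ⟶ u) : u.1 e.1 = v.1 e.1 + 1 := by
  rw [congr_fun e.2 e.1]
  simp

theorem apply_of_hom_of_ne {v u : StrictYoung k} (e : v ⟶ u) {j : Fin k} (hj : j ≠ e.1) :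
    u.1 j = v.1 j := by
  rw [congr_fun e.2 j]
  simp [hj]

theorem shiftedDiagram_eq_insert {v u : StrictYoung k} (e : v ⟶ u) :
    u.shiftedDiagram = insert (newCell e) v.shiftedDiagram := by
  ext ⟨j, c⟩
  simp only [shiftedDiagram, newCell, Set.mem_insert_iff, Set.mem_ofPred_eq, Prod.mk.injEq]
  by_cases hj : j = e.1
  · subst hj
    rw [apply_index_of_hom e]
    simp only [true_and]
    omega
  · rw [apply_of_hom_of_ne e hj]
    simp [hj]

theorem isStandardEnum_snoc {v u : StrictYoung k} (e : v ⟶ u) {n : ℕ} {g : Fin n → Fin k × ℕ}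
    (hg : v.IsStandardEnum g) :
    u.IsStandardEnum (Fin.snoc (α := fun _ => Fin k × ℕ) g (newCell e)) := by
  have hmem (s) : g s ∈ v.shiftedDiagram := hg.range_eq ▸ Set.mem_range_self s
  refine ⟨?_, ?_, ?_, ?_⟩
  · rw [Fin.snoc_injective_iff, hg.range_eq]
    exact ⟨hg.injective, newCell_notMem e⟩
  · rw [Fin.range_snoc, hg.range_eq, shiftedDiagram_eq_insert e]
  · intro s t
    induction s using Fin.lastCases with
    | last =>
      induction t using Fin.lastCases with
      | last => exact fun _ h => absurd h (lt_irrefl _)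
      | cast t =>
        simp only [Fin.snoc_last, Fin.snoc_castSucc]
        intro h1 h2
        have h3 := (hmem t).2
        rw [← h1] at h3
        exact absurd h2 (lt_asymm h3)
    | cast s =>
      induction t using Fin.lastCases with
      | last => exact fun _ _ => Fin.castSucc_lt_last s
      | cast t =>
        simpa only [Fin.snoc_castSucc, Fin.castSucc_lt_castSucc_iff] using hg.row s t
  · intro s t
    induction s using Fin.lastCases with
    | last =>
      induction t using Fin.lastCases with
      | last => exact fun _ h => absurd h (lt_irrefl _)
      | cast t =>
        simp only [Fin.snoc_last, Fin.snoc_castSucc]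
        intro h1 h2
        have h3 := hmem t
        have h4 : (g t).2 = (e.1 : ℕ) + v.1 e.1 := h1.symm
        have h5 : e.1 < (g t).1 := h2
        -- A lower row of `v` cannot reach the column just past the end of row `e.1`.
        have h6 := v.add_le_add_of_le h5.le (by have := h3.1; have := h3.2; omega)
        have := h3.2
        omega
    | cast s =>
      induction t using Fin.lastCases with
      | last => exact fun _ _ => Fin.castSucc_lt_last s
      | cast t =>
        simpa only [Fin.snoc_castSucc, Fin.castSucc_lt_castSucc_iff] using hg.col s t

theorem IsStandardEnum.exists_last_eq_newCell {u : StrictYoung k} {n : ℕ}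
    {g : Fin (n + 1) → Fin k × ℕ} (hg : u.IsStandardEnum g) :
    ∃ e : u.InEdge, g (Fin.last n) = newCell e.2 := by
  have hp : g (Fin.last n) ∈ u.shiftedDiagram := hg.range_eq ▸ Set.mem_range_self _
  obtain ⟨⟨i, c⟩, hgl⟩ : ∃ p, g (Fin.last n) = p := ⟨_, rfl⟩
  rw [hgl] at hp
  obtain ⟨hp1, hp2⟩ : (i : ℕ) ≤ c ∧ c < (i : ℕ) + u.1 i := hp
  have hrow : (i, c + 1) ∉ u.shiftedDiagram := by
    rw [← hg.range_eq]
    rintro ⟨s, hs⟩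
    exact (Fin.le_last s).not_gt
      (hg.row (Fin.last n) s (by rw [hgl, hs]) (by rw [hgl, hs]; exact Nat.lt_succ_self c))
  have hc : c + 1 = (i : ℕ) + u.1 i := by
    by_contra h
    exact hrow ⟨hp1.trans (Nat.le_succ c), show c + 1 < (i : ℕ) + u.1 i by omega⟩
  obtain ⟨e, rfl⟩ := u.exists_inEdge (i := i) (by omega) <| by
    -- A non-empty lower row of length `u.1 i - 1` would contain a cell of column `c`, below the
    -- largest entry.
    intro j hij hj
    by_contra h0
    have hle := u.add_le_add_of_le hij.le (Nat.pos_of_ne_zero h0)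
    have hcol : (j, c) ∈ u.shiftedDiagram :=
      ⟨show (j : ℕ) ≤ c by omega, show c < (j : ℕ) + u.1 j by
        have := Fin.lt_def.1 hij
        omega⟩
    rw [← hg.range_eq] at hcol
    obtain ⟨s, hs⟩ := hcol
    exact (Fin.le_last s).not_gt
      (hg.col (Fin.last n) s (by rw [hgl, hs]) (by rw [hgl, hs]; exact hij))
  refine ⟨e, hgl.trans (Prod.ext rfl ?_)⟩
  have := apply_index_of_hom e.2
  simp only [newCell]
  omega

theorem IsStandardEnum.init {v u : StrictYoung k} (e : v ⟶ u) {n : ℕ}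
    {g : Fin (n + 1) → Fin k × ℕ} (hg : u.IsStandardEnum g) (hl : g (Fin.last n) = newCell e) :
    v.IsStandardEnum fun s : Fin n => g s.castSucc where
  injective := hg.injective.comp (Fin.castSucc_injective n)
  range_eq := by
    have h := hg.range_eq
    have hinj := hg.injective
    rw [← Fin.snoc_init_self g] at h hinj
    rw [Fin.range_snoc, hl, shiftedDiagram_eq_insert e] at h
    have hn := (Fin.snoc_injective_iff.1 hinj).2
    rw [hl] at hn
    change Set.range (Fin.init g) = _
    rw [← Set.insert_sdiff_self_of_notMem hn, h,
      Set.insert_sdiff_self_of_notMem (newCell_notMem e)]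
  row s t h1 h2 := Fin.castSucc_lt_castSucc_iff.1 (hg.row _ _ h1 h2)
  col s t h1 h2 := Fin.castSucc_lt_castSucc_iff.1 (hg.col _ _ h1 h2)

/-- Removing the last cell from a standard enumeration. -/
noncomputable def standardEnumEquiv (u : StrictYoung k) (n : ℕ) :
    (Σ e : u.InEdge, {g : Fin n → Fin k × ℕ // e.1.IsStandardEnum g}) ≃
      {g : Fin (n + 1) → Fin k × ℕ // u.IsStandardEnum g} :=
  Equiv.ofBijective (fun x => ⟨_, isStandardEnum_snoc x.1.2 x.2.2⟩) <| by
    constructor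
    · rintro ⟨e, g, hg⟩ ⟨f, g', hg'⟩ h
      have h' : Fin.snoc (α := fun _ => Fin k × ℕ) g (newCell e.2) = Fin.snoc g' (newCell f.2) :=
        congr_arg Subtype.val h
      obtain ⟨h1, h2⟩ := Fin.snoc_inj.1 h'
      obtain rfl : e = f := u.inEdge_index_injective (congr_arg Prod.fst h2)
      obtain rfl : g = g' := h1
      rfl
    · rintro ⟨g, hg⟩
      obtain ⟨e, he⟩ := hg.exists_last_eq_newCell
      refine ⟨⟨e, _, hg.init e.2 he⟩, Subtype.ext ?_⟩
      exact (congr_arg (Fin.snoc _) he.symm).trans (Fin.snoc_init_self g)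

theorem nonempty_pathEquiv_standardEnum (n : ℕ) (u : StrictYoung k) (hu : ∑ i, u.1 i = n) :
    Nonempty (Quiver.Path (origin k) u ≃ {g : Fin n → Fin k × ℕ // u.IsStandardEnum g}) := by
  induction n generalizing u with
  | zero =>
    obtain rfl := eq_origin_of_sum_eq_zero hu
    have : Unique (Quiver.Path (origin k) (origin k)) := ⟨⟨.nil⟩, path_origin_origin⟩
    have hst : (origin k).IsStandardEnum (Fin.elim0 : Fin 0 → Fin k × ℕ) := by
      refine ⟨fun s => s.elim0, ?_, fun s => s.elim0, fun s => s.elim0⟩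
      rw [Set.range_eq_empty, eq_comm, Set.eq_empty_iff_forall_notMem]
      exact fun p hp => hp.1.not_gt hp.2
    have : Unique {g : Fin 0 → Fin k × ℕ // (origin k).IsStandardEnum g} :=
      ⟨⟨⟨_, hst⟩⟩, fun g => Subsingleton.elim _ _⟩
    exact ⟨Equiv.ofUnique _ _⟩
  | succ n ih =>
    have ih' (e : u.InEdge) := (ih e.1 (by have := sum_eq_of_hom e.2; omega)).some
    exact ⟨(u.pathEquiv (by omega)).symm.trans
      ((Equiv.sigmaCongrRight ih').trans (u.standardEnumEquiv n))⟩

end StrictYoung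

theorem mainTheorem3 (k : ℕ) (u : StrictYoung k) :
    ((StrictYoung.origin k).pathCount u : ℚ) =
        (∏ i : Fin k, ∏ j ∈ Finset.Ioi i, strictFactor (u.1 i) (u.1 j)) *
          ((Nat.factorial (∑ i, u.1 i) : ℚ) / ∏ i, (Nat.factorial (u.1 i) : ℚ)) ∧
      (StrictYoung.origin k).pathCount u = Nat.card u.ShiftedTableau :=
  ⟨(StrictYoung.finite_path_and_pathCount_eq _ u rfl).2,
    Nat.card_congr
      ((StrictYoung.nonempty_pathEquiv_standardEnum _ u rfl).some.trans
        u.shiftedTableauEquiv.symm)⟩
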